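/- For every integer $n\ge 1$ there is a constant $C=C(n)$, depending only on $n$, such that the following holds. Let $\mathbb F$ be any field, let $d\ge 1$ and let $k_1,\dots,k_d\ge 1$ be integers with $k_1+\dots+k_d=n$. Write $\mathrm{Gr}(k,\mathbb F^n)$ for the set of $k$-dimensional linear subspaces of $\mathbb F^n$; for an affine $k$-plane $\pi\subset\mathbb F^n$ let $e(\pi)\in\mathrm{Gr}(k,\mathbb F^n)$ be the translate of $\pi$ containing the origin; and for $V_j\in\mathrm{Gr}(k_j,\mathbb F^n)$, $1\le j\le d$, let the discrete wedge product $V_1\wedge\dots\wedge V_d$ be $1$ if $V_1,\dots,V_d$ together span $\mathbb F^n$, and $0$ otherwise. Then for every finitely supported $S:\mathbb F^n\to\mathbb R_{\ge 0}$ with $\|S\|_d=\bigl(\sum_{p\in\mathbb F^n}S(p)^d\bigr)^{1/d}=1$ there exist functions $s_k:\mathbb F^n\times\mathrm{Gr}(k,\mathbb F^n)\to\mathbb R_{\ge 0}$, one for each $k\in\{k_1,\dots,k_d\}$, such that $$(V_1\wedge\dots\wedge V_d)\,S(p)^d\le C\prod_{j=1}^d s_{k_j}(p,V_j)$$ for all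 $p\in\mathbb F^n$ and all $V_j\in\mathrm{Gr}(k_j,\mathbb F^n)$, $1\le j\le d$, and such that for every $1\le j\le d$ $$\sum_{p\in\pi_j}s_{k_j}(p,e(\pi_j))\le 1$$ for every affine $k_j$-plane $\pi_j\subset\mathbb F^n$. -/

import Mathlib

open scoped NNReal ENNReal

/-- The Grassmannian `Gr(k, 𝔽ⁿ)`: the set of all `k`-dimensional linear subspaces of `𝔽ⁿ`. -/
def Gr (k : ℕ) (F : Type*) [Field F] (n : ℕ) : Type _ :=
  {V : Submodule F (Fin n → F) // Module.finrank F V = k}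

/-- The affine `k`-planes in `𝔽ⁿ` (nonempty affine subspaces of dimension `k`). -/
def AffinePlane (k : ℕ) (F : Type*) [Field F] (n : ℕ) : Type _ :=
  {π : AffineSubspace F (Fin n → F) //
    (π : Set (Fin n → F)).Nonempty ∧ Module.finrank F π.direction = k}

/-- `e(π)`: the translate of the affine plane `π` that contains the origin. -/
def AffinePlane.e {k : ℕ} {F : Type*} [Field F] {n : ℕ} (π : AffinePlane k F n) : Gr k F n :=
  ⟨π.1.direction, π.2.2⟩

/-- The norm `‖S‖_d = (∑ₚ S(p)^d)^(1/d)` of a function on `𝔽ⁿ` (counting measure). -/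
noncomputable def discreteNorm (d : ℕ) {F : Type*} {n : ℕ} (S : (Fin n → F) → ℝ≥0) : ℝ≥0 :=
  (∑' p, S p ^ d) ^ (1 / (d : ℝ))

open Classical in
/-- The discrete wedge product of directions (given by spanning vectors): `1` if they span `𝔽ⁿ`,
and `0` otherwise. -/
noncomputable def directionWedge {F : Type*} [Field F] {n : ℕ} {ι : Type*}
    (ω : ι → Fin n → F) : ℝ≥0 :=
  if Submodule.span F (Set.range ω) = ⊤ then 1 else 0

open Classical in
/-- The discrete wedge product `V₁ ∧ ⋯ ∧ V_d` of subspaces: `1` if together they span `𝔽ⁿ`, and `0`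
otherwise. By `discreteWedge_eq_directionWedge` it is the wedge product of any choice of linearly
independent directions `ω_{j,1}, …, ω_{j,k_j}` in the `V_j`. -/
noncomputable def discreteWedge {F : Type*} [Field F] {n d : ℕ} {k : Fin d → ℕ}
    (V : ∀ j, Gr (k j) F n) : ℝ≥0 :=
  if (⨆ j, (V j).1) = ⊤ then 1 else 0

theorem discreteWedge_eq_directionWedge {F : Type*} [Field F] {n d : ℕ} {k : Fin d → ℕ}
    (V : ∀ j, Gr (k j) F n) (ω : ∀ j, Fin (k j) → Fin n → F)
    (hω : ∀ j, LinearIndependent F (ω j)) (hV : ∀ j i, ω j i ∈ (V j).1) :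
    discreteWedge V = directionWedge (fun x : Σ j, Fin (k j) => ω x.1 x.2) := by
  have h : ∀ j, Submodule.span F (Set.range (ω j)) = (V j).1 := by
    intro j
    apply Submodule.eq_of_le_of_finrank_eq
    · rw [Submodule.span_le]
      rintro _ ⟨i, rfl⟩
      exact hV j i
    · rw [finrank_span_eq_card (hω j), Fintype.card_fin, (V j).2]
  have h2 : Submodule.span F (Set.range (fun x : Σ j, Fin (k j) => ω x.1 x.2))
      = ⨆ j, (V j).1 := by
    rw [Set.range_sigma_eq_iUnion_range, Submodule.span_iUnion]
    exact iSup_congr h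
  unfold discreteWedge directionWedge
  rw [h2]

/-! The proof is the polynomial method with handicaps. Let `P` be the support of `S`. On a plane,
consider the conditions "the coefficient of exponent `m` at the point `q` of `P` vanishes", ordered
by `m.degree - α q` for a handicap `α`. A pivot at `p` is an exponent whose condition does not
follow, for polynomials of degree at most `N`, from the earlier ones. The function `s_k(p, V)` is
the number of pivots at `p` along `V`, divided by `(N + 1) ^ k`.

Pivots on one plane yield linearly independent polynomials, so they number at most `(N + 1) ^ k`
(`sum_ncard_pivots_le`); this is the bound on planes.

Conversely, choose spanning subspaces at every point. For a nonzero polynomial on the whole space,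
take the point minimising its order of vanishing minus `α`: in adapted coordinates some leading
exponent there consists of pivots, block by block (`exists_pivots_coeff_ne_zero`). Hence the
products of pivot counts sum over `P` to at least the dimension of the polynomial space
(`pow_le_sum_prod_ncard_pivots`).

It remains to distribute this total according to `S(p)^d`. Raising `α p` by one does not increase
the counts at other points and increases the minimal product at `p` only by a term of order `N ^ (n
- 1)`. For large `N` the handicaps can therefore be tuned (`exists_handicap`) until every point has
at least half its share. -/

/-! ### Translations, linear substitutions and orders of vanishing -/

open MvPolynomial in
/-- The substitution `X ↦ X + t`. -/
noncomputable def MvPolynomial.shift {σ F : Type*} [Field F] (t : σ → F) :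
    MvPolynomial σ F →ₐ[F] MvPolynomial σ F :=
  aeval fun i => X i + C (t i)

open MvPolynomial in
/-- The substitution of the linear map `A` into a polynomial. -/
noncomputable def MvPolynomial.linSubst {σ τ F : Type*} [Field F] [Fintype σ] [DecidableEq σ]
    (A : (σ → F) →ₗ[F] (τ → F)) : MvPolynomial τ F →ₐ[F] MvPolynomial σ F :=
  aeval fun i => ∑ s, C (A (Pi.single s 1) i) * X s

namespace MvPolynomial

variable {σ τ F : Type*} [Field F]

@[simp]
theorem shift_X (t : σ → F) (i : σ) : shift t (X i : MvPolynomial σ F) = X i + C (t i) := by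
  simp [shift]

@[simp]
theorem shift_C (t : σ → F) (a : F) : shift t (C a : MvPolynomial σ F) = C a := by
  simp [shift]

theorem shift_shift (t u : σ → F) (h : MvPolynomial σ F) :
    shift t (shift u h) = shift (t + u) h := by
  have : (shift t).comp (shift u) = shift (F := F) (t + u) := by
    ext1 i
    simp [add_assoc]
  exact DFunLike.congr_fun this h

@[simp]
theorem shift_zero (h : MvPolynomial σ F) : shift (0 : σ → F) h = h := by
  have : shift (0 : σ → F) = AlgHom.id F (MvPolynomial σ F) := by
    ext1 i
    simp
  exact DFunLike.congr_fun this h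

theorem totalDegree_aeval_le_of_le_one (f : σ → MvPolynomial τ F)
    (hf : ∀ i, (f i).totalDegree ≤ 1) (h : MvPolynomial σ F) :
    (aeval f h).totalDegree ≤ h.totalDegree := by
  rw [aeval_def, eval₂_eq]
  refine totalDegree_finsetSum_le fun m hm => ?_
  refine (totalDegree_mul _ _).trans ?_
  rw [algebraMap_eq, totalDegree_C, zero_add]
  refine (totalDegree_finsetProd _ _).trans ?_
  refine le_trans ?_ (le_totalDegree hm)
  refine Finset.sum_le_sum fun i _ => (totalDegree_pow _ _).trans ?_
  simpa using Nat.mul_le_mul_left (m i) (hf i)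

theorem totalDegree_shift_le (t : σ → F) (h : MvPolynomial σ F) :
    (shift t h).totalDegree ≤ h.totalDegree := by
  refine totalDegree_aeval_le_of_le_one _ (fun i => ?_) h
  refine (totalDegree_add _ _).trans ?_
  simp

theorem totalDegree_linSubst_le [Fintype σ] [DecidableEq σ] (A : (σ → F) →ₗ[F] (τ → F))
    (h : MvPolynomial τ F) : (linSubst A h).totalDegree ≤ h.totalDegree := by
  refine totalDegree_aeval_le_of_le_one _ (fun i => ?_) h
  refine totalDegree_finsetSum_le fun s _ => (totalDegree_mul _ _).trans ?_
  simp

theorem _root_.LinearMap.pi_apply_apply_eq_sum [Fintype σ] [DecidableEq σ]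
    (A : (σ → F) →ₗ[F] (τ → F)) (t : σ → F) (i : τ) :
    A t i = ∑ s, t s * A (Pi.single s 1) i := by
  conv_lhs => rw [pi_eq_sum_univ' t]
  simp [Finset.sum_apply]

theorem shift_linSubst [Fintype σ] [DecidableEq σ] (A : (σ → F) →ₗ[F] (τ → F)) (t : σ → F)
    (h : MvPolynomial τ F) : shift t (linSubst A h) = linSubst A (shift (A t) h) := by
  have : (shift t).comp (linSubst A) = (linSubst A).comp (shift (A t)) := by
    ext1 i
    have hA := LinearMap.pi_apply_apply_eq_sum A t i
    simp only [AlgHom.coe_comp, Function.comp_apply, linSubst, aeval_X, map_sum, map_mul, shift_C,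
      shift_X, mul_add, Finset.sum_add_distrib, map_add, aeval_C, algebraMap_eq, hA]
    simp only [mul_comm]
  exact DFunLike.congr_fun this h

theorem linSubst_linSubst_symm [Fintype σ] [DecidableEq σ] [Fintype τ] [DecidableEq τ]
    (A : (σ → F) ≃ₗ[F] (τ → F)) (h : MvPolynomial τ F) :
    linSubst A.symm.toLinearMap (linSubst A.toLinearMap h) = h := by
  have : (linSubst A.symm.toLinearMap).comp (linSubst A.toLinearMap)
      = AlgHom.id F (MvPolynomial τ F) := by
    ext1 i
    have key : ∀ j, ∑ s, A (Pi.single s 1) i * A.symm (Pi.single j 1) s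
        = if j = i then 1 else 0 := by
      intro j
      have h1 : A (A.symm (Pi.single j 1)) i = (Pi.single j 1 : τ → F) i := by simp
      have h2 := LinearMap.pi_apply_apply_eq_sum A.toLinearMap (A.symm (Pi.single j 1)) i
      simp only [LinearEquiv.coe_coe] at h2
      rw [h1, Pi.single_apply] at h2
      simp only [mul_comm (A _ _), ← h2, eq_comm]
    simp only [linSubst, LinearEquiv.coe_coe, AlgHom.coe_comp, Function.comp_apply, aeval_X,
      map_sum, map_mul, AlgHom.coe_id, id_eq]
    simp only [aeval_C, algebraMap_eq, Finset.mul_sum]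
    rw [Finset.sum_comm]
    simp only [← mul_assoc, ← C_mul, ← Finset.sum_mul, ← map_sum, key]
    simp
  exact DFunLike.congr_fun this h

theorem linSubst_mem_pow_idealOfVars [Fintype σ] [DecidableEq σ] (A : (σ → F) →ₗ[F] (τ → F))
    {r : ℕ} {h : MvPolynomial τ F} (hh : h ∈ idealOfVars τ F ^ r) :
    linSubst A h ∈ idealOfVars σ F ^ r := by
  have h1 : Ideal.map (linSubst A) (idealOfVars τ F) ≤ idealOfVars σ F := by
    rw [Ideal.map_span, Ideal.span_le]
    rintro _ ⟨_, ⟨i, rfl⟩, rfl⟩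
    simp only [linSubst, aeval_X]
    exact Ideal.sum_mem _ fun s _ => Ideal.mul_mem_left _ _ (Ideal.subset_span ⟨s, rfl⟩)
  have h2 := Ideal.mem_map_of_mem (linSubst A) hh
  rw [Ideal.map_pow] at h2
  exact Ideal.pow_right_mono h1 r h2

theorem exists_order {f : MvPolynomial σ F} (hf : f ≠ 0) :
    ∃ r ≤ f.totalDegree, f ∈ idealOfVars σ F ^ r ∧ f ∉ idealOfVars σ F ^ (r + 1) := by
  obtain ⟨m, hm, hmin⟩ := f.support.exists_min_image Finsupp.degree (support_nonempty.mpr hf)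
  refine ⟨m.degree, le_totalDegree hm, ?_, ?_⟩
  · rw [mem_pow_idealOfVars_iff]
    exact hmin
  · rw [mem_pow_idealOfVars_iff]
    exact fun h => by simpa using h m hm

/-- A factor with constant term `1` changes only terms above the lowest order. -/
theorem coeff_mul_of_mem_pow_idealOfVars {h u : MvPolynomial σ F} {m : σ →₀ ℕ}
    (hh : h ∈ idealOfVars σ F ^ m.degree) (hu : u - 1 ∈ idealOfVars σ F) :
    coeff m (h * u) = coeff m h := by
  have h1 : h * (u - 1) ∈ idealOfVars σ F ^ (m.degree + 1) := by
    rw [pow_succ]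
    exact Ideal.mul_mem_mul hh hu
  rw [mem_pow_idealOfVars_iff'] at h1
  have := h1 m (Nat.lt_succ_self _)
  rw [mul_sub, mul_one, coeff_sub, sub_eq_zero] at this
  exact this

end MvPolynomial

/-! ### Slices of a polynomial along a block of variables -/

open MvPolynomial in
theorem MvPolynomial.sumAlgEquiv_monomial {S₁ S₂ R : Type*} [CommRing R] (m : S₁ ⊕ S₂ →₀ ℕ)
    (a : R) : sumAlgEquiv R S₁ S₂ (monomial m a) =
      monomial (Finsupp.sumFinsuppEquivProdFinsupp m).1
        (monomial (Finsupp.sumFinsuppEquivProdFinsupp m).2 a) := by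
  simp [sumAlgEquiv, monomial, Finsupp.sumFinsuppAddEquivProdFinsupp,
    Finsupp.sumFinsuppEquivProdFinsupp, AddMonoidAlgebra.curryAlgEquiv_single]

open MvPolynomial in
theorem MvPolynomial.coeff_coeff_sumAlgEquiv {S₁ S₂ R : Type*} [CommRing R]
    (G : MvPolynomial (S₁ ⊕ S₂) R) (M : S₁ →₀ ℕ) (m : S₂ →₀ ℕ) :
    coeff m (coeff M (sumAlgEquiv R S₁ S₂ G)) = coeff (Finsupp.sumElim M m) G := by
  classical
  induction G using MvPolynomial.induction_on' with
  | monomial u a =>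
    rw [sumAlgEquiv_monomial, ← Finsupp.sumFinsuppEquivProdFinsupp_symm_apply (M, m)]
    simp only [coeff_monomial, apply_ite (coeff m), coeff_zero, Equiv.eq_symm_apply,
      Prod.ext_iff, ite_and]
  | add p q hp hq => simp [hp, hq]

open MvPolynomial in
/-- Freezing the exponents outside the block `ι` commutes with translations along that block. -/
theorem MvPolynomial.exists_slice {σ τ F : Type*} [Field F] (ι : τ → σ) (hι : Function.Injective ι)
    (glue : (τ →₀ ℕ) → (σ →₀ ℕ)) (hin : ∀ m i, glue m (ι i) = m i)
    (hout : ∀ m m' s, s ∉ Set.range ι → glue m s = glue m' s) :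
    ∃ E : MvPolynomial σ F → MvPolynomial τ F,
      (∀ G m, coeff m (E G) = coeff (glue m) G) ∧
      ∀ (t : τ → F) (u : σ → F), (∀ i, u (ι i) = t i) → (∀ s ∉ Set.range ι, u s = 0) →
        ∀ G, E (shift u G) = shift t (E G) := by
  classical
  let e : {s : σ // s ∉ Set.range ι} ⊕ τ ≃ σ :=
    (Equiv.sumComm _ _).trans ((Equiv.sumCongr (Equiv.ofInjective ι hι) (Equiv.refl _)).trans
      (Equiv.Set.sumCompl (Set.range ι)))
  have he1 : ∀ s : {s : σ // s ∉ Set.range ι}, e (Sum.inl s) = s := fun s => rfl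
  have he2 : ∀ i, e (Sum.inr i) = ι i := fun i => rfl
  let M : {s : σ // s ∉ Set.range ι} →₀ ℕ :=
    (glue 0).comapDomain Subtype.val Subtype.val_injective.injOn
  -- The block variables go into the coefficient ring, where translations along the block act
  -- coefficientwise.
  let Ψ : MvPolynomial σ F →ₐ[F] MvPolynomial {s : σ // s ∉ Set.range ι} (MvPolynomial τ F) :=
    (sumAlgEquiv F _ _).toAlgHom.comp (renameEquiv F e.symm).toAlgHom
  refine ⟨fun G => coeff M (Ψ G), fun G m => ?_, fun t u h1 h2 G => ?_⟩
  · change coeff m (coeff M (sumAlgEquiv F _ _ (rename e.symm G))) = _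
    rw [coeff_coeff_sumAlgEquiv]
    have : Finsupp.sumElim M m = (glue m).mapDomain e.symm := by
      ext x
      rw [← e.symm_apply_apply x, Finsupp.mapDomain_apply e.symm.injective, e.symm_apply_apply]
      rcases x with s | i
      · rw [he1, Finsupp.sumElim_inl, hout m 0 s s.2]
        rfl
      · rw [he2, hin, Finsupp.sumElim_inr]
    rw [this, coeff_rename_mapDomain _ e.symm.injective]
  · have : Ψ.comp (shift u) = (mapAlgHom (shift t)).comp Ψ := by
      ext1 s
      obtain ⟨x, rfl⟩ := e.surjective s
      rcases x with s | i
      · simp [Ψ, he1, h2 s s.2]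
        simp [← he1]
      · simp [Ψ, he2, h1]
        simp [← he2]
    have := DFunLike.congr_fun this G
    simp only [AlgHom.coe_comp, Function.comp_apply] at this
    change coeff M (Ψ (shift u G)) = _
    rw [this]
    exact coeff_map (shift t).toRingHom (Ψ G) M

/-! ### Linear independence from pivots -/

/-- A triangular family of vectors, none of whose pivots is a pivot of `X`, is linearly
independent modulo `X`. -/
theorem card_pivots_add_finrank_le {K Y T κ : Type*} [Field K] [AddCommGroup Y] [Module K Y]
    [LinearOrder κ] (X Z : Submodule K Y) [FiniteDimensional K Z] (hXZ : X ≤ Z) (key : T → κ)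
    (ℓ : T → Y →ₗ[K] K) (S : Finset T) (hkey : Set.InjOn key S)
    (hS : ∀ t ∈ S, ∃ h ∈ Z, ℓ t h ≠ 0 ∧ ∀ s, key s < key t → ℓ s h = 0)
    (hX : ∀ t ∈ S, ∀ h ∈ X, (∀ s, key s < key t → ℓ s h = 0) → ℓ t h = 0) :
    S.card + Module.finrank K X ≤ Module.finrank K Z := by
  classical
  choose! h hZ hne hlt using hS
  let Φ : ((S → K) × X) →ₗ[K] Z :=
    LinearMap.coprod
      (Fintype.linearCombination K (fun t : S => (⟨h t, hZ t t.2⟩ : Z))) (Submodule.inclusion hXZ)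
  have hΦ : ∀ c x, ((Φ (c, x) : Z) : Y) = ∑ t : S, c t • h t + x := by
    intro c x
    simp [Φ, Fintype.linearCombination_apply]
  have hinj : Function.Injective Φ := by
    rw [injective_iff_map_eq_zero]
    rintro ⟨c, x⟩ h0
    have h1 : ∑ t : S, c t • h t + (x : Y) = 0 := by rw [← hΦ, h0]; rfl
    have hc : c = 0 := by
      by_contra hc
      obtain ⟨t0, ht0⟩ := Function.ne_iff.mp hc
      -- At the smallest key with a nonzero coefficient, the combination would be an element of `X`
      -- with pivot `t`.
      obtain ⟨t, ht, hmin⟩ := (Finset.univ.filter fun t : S => c t ≠ 0).exists_min_image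
        (fun t => key t) ⟨t0, by simpa using ht0⟩
      simp only [Finset.mem_filter, Finset.mem_univ, true_and] at ht hmin
      have hx : (x : Y) = -∑ s : S, c s • h s := eq_neg_of_add_eq_zero_right h1
      have hbefore : ∀ s, key s < key t → ℓ s x = 0 := by
        intro s hs
        rw [hx, map_neg, map_sum, neg_eq_zero]
        refine Finset.sum_eq_zero fun u _ => ?_
        by_cases hu : c u = 0
        · simp [hu]
        · rw [map_smul, hlt u u.2 s (hs.trans_le (hmin u hu)), smul_zero]
      have hval := hX t t.2 x x.2 hbefore
      rw [hx, map_neg, map_sum, neg_eq_zero, Finset.sum_eq_single t] at hval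
      · rw [map_smul, smul_eq_mul] at hval
        exact mul_ne_zero ht (hne t t.2) hval
      · intro u _ hut
        by_cases hu : c u = 0
        · simp [hu]
        · have : key t < key u := lt_of_le_of_ne (hmin u hu) fun he =>
            hut (Subtype.ext (hkey t.2 u.2 he)).symm
          rw [map_smul, hlt u u.2 t this, smul_zero]
      · simp
    subst hc
    simpa using h1
  have : FiniteDimensional K X := Submodule.finiteDimensional_of_le hXZ
  have hle := LinearMap.finrank_le_finrank_of_injective hinj
  simpa [Module.finrank_prod] using hle

/-! ### Dimensions of spaces of polynomials of bounded degree -/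

section counting

variable {F : Type*} [Field F]

theorem finrank_restrictTotalDegree (σ : Type*) (N : ℕ) :
    Module.finrank F (MvPolynomial.restrictTotalDegree σ F N)
      = Set.ncard {m : σ →₀ ℕ | m.degree ≤ N} :=
  Module.finrank_eq_nat_card_basis (MvPolynomial.basisRestrictSupport F _)

instance (σ : Type*) [Finite σ] (N : ℕ) :
    FiniteDimensional F (MvPolynomial.restrictTotalDegree σ F N) :=
  haveI : Finite {m : σ →₀ ℕ | (m.sum fun _ e => e) ≤ N} := Finsupp.finite_of_degree_le N
  Module.Finite.of_basis (MvPolynomial.basisRestrictSupport F _)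

theorem ncard_degree_le (k N : ℕ) :
    Set.ncard {m : Fin k →₀ ℕ | m.degree ≤ N} ≤ (N + 1) ^ k := by
  have h := Set.ncard_le_ncard_of_injOn (s := {m : Fin k →₀ ℕ | m.degree ≤ N})
    (t := (Set.univ : Set (Fin k → Fin (N + 1))))
    (fun m i => Fin.ofNat (N + 1) (m i)) (fun _ _ => Set.mem_univ _) ?_
  · simpa [Set.ncard_univ] using h
  · intro m hm m' hm' he
    ext i
    have := congrArg Fin.val (congrFun he i)
    simp only [Fin.ofNat] at this
    rwa [Nat.mod_eq_of_lt (Nat.lt_succ_of_le ((Finsupp.le_degree i m).trans hm)),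
      Nat.mod_eq_of_lt (Nat.lt_succ_of_le ((Finsupp.le_degree i m').trans hm'))] at this

theorem pow_le_ncard_degree_le (n T : ℕ) :
    (T + 1) ^ n ≤ Set.ncard {m : Fin n →₀ ℕ | m.degree ≤ n * T} := by
  have h := Set.ncard_le_ncard_of_injOn (s := (Set.univ : Set (Fin n → Fin (T + 1))))
    (t := {m : Fin n →₀ ℕ | m.degree ≤ n * T})
    (fun f => Finsupp.equivFunOnFinite.symm fun i => (f i : ℕ)) ?_ ?_
    (Finsupp.finite_of_degree_le _)
  · simpa [Set.ncard_univ] using h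
  · intro f _
    simp only [Set.mem_ofPred_eq, Finsupp.degree_eq_sum, Finsupp.coe_equivFunOnFinite_symm]
    refine (Finset.sum_le_card_nsmul _ _ T fun i _ => Nat.lt_succ_iff.mp (f i).2).trans ?_
    simp
  · intro f _ g _ he
    ext i
    exact DFunLike.congr_fun he i

/-- An exponent of degree in `(N, N + M]` is determined by its degree and all its coordinates but
the first. -/
theorem ncard_degree_le_add (k N M : ℕ) (hk : 1 ≤ k) :
    Set.ncard {m : Fin k →₀ ℕ | m.degree ≤ N + M}
      ≤ Set.ncard {m : Fin k →₀ ℕ | m.degree ≤ N} + M * (N + M + 1) ^ (k - 1) := by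
  obtain ⟨k, rfl⟩ : ∃ j, k = j + 1 := ⟨k - 1, by omega⟩
  have hsub : {m : Fin (k + 1) →₀ ℕ | m.degree ≤ N + M} ⊆ {m | m.degree ≤ N} ∪
      {m | N < m.degree ∧ m.degree ≤ N + M} := by
    intro m hm
    simp only [Set.mem_ofPred_eq, Set.mem_union] at hm ⊢
    omega
  have hfin : ({m | m.degree ≤ N} ∪ {m | N < m.degree ∧ m.degree ≤ N + M} :
      Set (Fin (k + 1) →₀ ℕ)).Finite := (Finsupp.finite_of_degree_le _).union
      ((Finsupp.finite_of_degree_le (N + M)).subset fun m hm => hm.2)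
  refine (Set.ncard_le_ncard hsub hfin).trans ((Set.ncard_union_le _ _).trans ?_)
  gcongr
  have hsum : ∀ m : Fin (k + 1) →₀ ℕ, m.degree = m 0 + ∑ i : Fin k, m i.succ := fun m => by
    rw [Finsupp.degree_eq_sum, Fin.sum_univ_succ]
  have h := Set.ncard_le_ncard_of_injOn
    (s := {m : Fin (k + 1) →₀ ℕ | N < m.degree ∧ m.degree ≤ N + M})
    (t := ((Finset.range M ×ˢ Fintype.piFinset fun _ : Fin k => Finset.range (N + M + 1) :
      Finset (ℕ × (Fin k → ℕ))) : Set (ℕ × (Fin k → ℕ))))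
    (fun m => (m.degree - N - 1, fun i => m i.succ)) ?_ ?_
  · rw [Set.ncard_coe_finset] at h
    simpa using h
  · rintro m ⟨h1, h2⟩
    simp only [Finset.coe_product, Set.mem_prod, Finset.mem_coe, Finset.mem_range,
      Fintype.mem_piFinset]
    refine ⟨by omega, fun i => Nat.lt_succ_of_le ((Finsupp.le_degree i.succ m).trans h2)⟩
  · rintro m ⟨h1, -⟩ m' ⟨h1', -⟩ he
    simp only [Prod.mk.injEq] at he
    have hd : m.degree = m'.degree := by omega
    have ht : ∀ i : Fin k, m i.succ = m' i.succ := fun i => congrFun he.2 i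
    rw [hsum, hsum, Finset.sum_congr rfl fun i _ => ht i] at hd
    ext i
    refine Fin.cases ?_ ht i
    omega

end counting

/-! ### Handicaps and pivots on a plane -/

/-- The priority of the coefficient of exponent `m` at `q`, for the handicap `α`: conditions of
smaller key are imposed earlier. Ties between points are broken by `ρ`. -/
noncomputable def handicapKey {E : Type*} {k : ℕ} (α ρ : E → ℕ) (q : E)
    (m : Fin k →₀ ℕ) : ℤ ×ₗ (ℕ ×ₗ ℕ) :=
  toLex ((m.degree : ℤ) - α q, toLex (ρ q, Encodable.encode m))

theorem handicapKey_lt_iff {E : Type*} {k : ℕ} {α ρ : E → ℕ} {q q' : E} {m m' : Fin k →₀ ℕ} :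
    handicapKey α ρ q m < handicapKey α ρ q' m' ↔
      m.degree + α q' < m'.degree + α q ∨ (m.degree + α q' = m'.degree + α q ∧
        (ρ q < ρ q' ∨ (ρ q = ρ q' ∧ Encodable.encode m < Encodable.encode m'))) := by
  simp only [handicapKey, Prod.Lex.toLex_lt_toLex]
  omega

open MvPolynomial in
/-- The exponents of the leading monomials at `p` of the polynomials of degree at most `N` on the
plane `p + A(Fᵏ)` which satisfy all conditions at points of `P` of higher priority. -/
def pivots {F : Type*} [Field F] {n k : ℕ} (P : Finset (Fin n → F)) (ρ α : (Fin n → F) → ℕ) (N : ℕ)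
    (A : (Fin k → F) →ₗ[F] (Fin n → F)) (p : Fin n → F) : Set (Fin k →₀ ℕ) :=
  {m | ∃ h : MvPolynomial (Fin k) F, h.totalDegree ≤ N ∧ coeff m h ≠ 0 ∧
    ∀ t, p + A t ∈ P → ∀ m', handicapKey α ρ (p + A t) m' < handicapKey α ρ p m →
      coeff m' (shift t h) = 0}

section pivots

open MvPolynomial

variable {F : Type*} [Field F] {n k : ℕ} {P : Finset (Fin n → F)} {ρ α : (Fin n → F) → ℕ} {N : ℕ}
  {A : (Fin k → F) →ₗ[F] (Fin n → F)} {p : Fin n → F}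

theorem pivots_subset (P : Finset (Fin n → F)) (ρ α : (Fin n → F) → ℕ) (N : ℕ)
    (A : (Fin k → F) →ₗ[F] (Fin n → F)) (p : Fin n → F) :
    pivots P ρ α N A p ⊆ {m | m.degree ≤ N} := by
  rintro m ⟨h, hN, hm, -⟩
  exact (le_totalDegree (mem_support_iff.mpr hm)).trans hN

theorem finite_pivots (P : Finset (Fin n → F)) (ρ α : (Fin n → F) → ℕ) (N : ℕ)
    (A : (Fin k → F) →ₗ[F] (Fin n → F)) (p : Fin n → F) : (pivots P ρ α N A p).Finite :=
  (Finsupp.finite_of_degree_le N).subset (pivots_subset P ρ α N A p)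

theorem ncard_pivots_le (P : Finset (Fin n → F)) (ρ α : (Fin n → F) → ℕ) (N : ℕ)
    (A : (Fin k → F) →ₗ[F] (Fin n → F)) (p : Fin n → F) :
    (pivots P ρ α N A p).ncard ≤ (N + 1) ^ k :=
  (Set.ncard_le_ncard (pivots_subset P ρ α N A p) (Finsupp.finite_of_degree_le N)).trans
    (ncard_degree_le k N)

theorem injOn_handicapKey (hρ : Set.InjOn ρ P) (hA : Function.Injective A) (p : Fin n → F) :
    Function.Injective fun x : {t // p + A t ∈ P} × (Fin k →₀ ℕ) =>
      handicapKey α ρ (p + A x.1) x.2 := by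
  rintro ⟨⟨t, ht⟩, m⟩ ⟨⟨t', ht'⟩, m'⟩ he
  simp only [handicapKey, EmbeddingLike.apply_eq_iff_eq, Prod.mk.injEq,
    Encodable.encode_inj] at he
  have := hA (add_left_cancel (hρ ht ht' he.2.1))
  simp [this, he.2.2]

/-- The coefficient functionals at the points of a plane. -/
noncomputable def coeffAt (t : Fin k → F) (m : Fin k →₀ ℕ) : MvPolynomial (Fin k) F →ₗ[F] F :=
  (lcoeff F m).comp (shift t).toLinearMap

theorem coeffAt_apply (t : Fin k → F) (m : Fin k →₀ ℕ) (h : MvPolynomial (Fin k) F) :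
    coeffAt t m h = coeff m (shift t h) := rfl

/-- The witnesses of all these pivots, translated to the common origin `p₀`, form a triangular
family in the space of polynomials of degree at most `N`. -/
theorem sum_ncard_pivots_le (hρ : Set.InjOn ρ P) (hA : Function.Injective A) (p₀ : Fin n → F)
    (Q : Finset (Fin k → F)) (hQ : ∀ t ∈ Q, p₀ + A t ∈ P) :
    ∑ t ∈ Q, (pivots P ρ α N A (p₀ + A t)).ncard ≤ (N + 1) ^ k := by
  classical
  let S : Finset ({t // p₀ + A t ∈ P} × (Fin k →₀ ℕ)) :=
    (Q.attach.sigma fun t => (finite_pivots P ρ α N A (p₀ + A t)).toFinset).map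
      ⟨fun x => (⟨x.1, hQ _ x.1.2⟩, x.2), by
        rintro ⟨⟨t, ht⟩, m⟩ ⟨⟨t', ht'⟩, m'⟩ he
        simp only [Prod.mk.injEq, Subtype.mk.injEq] at he
        obtain ⟨rfl, rfl⟩ := he
        rfl⟩
  have hS : S.card = ∑ t ∈ Q, (pivots P ρ α N A (p₀ + A t)).ncard := by
    rw [Finset.card_map, Finset.card_sigma, ← Finset.sum_attach Q]
    exact Finset.sum_congr rfl fun t _ => (Set.ncard_eq_toFinset_card _ _).symm
  have := card_pivots_add_finrank_le (⊥ : Submodule F (MvPolynomial (Fin k) F))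
    (restrictTotalDegree (Fin k) F N) bot_le
    (fun x : {t // p₀ + A t ∈ P} × (Fin k →₀ ℕ) => handicapKey α ρ (p₀ + A x.1) x.2)
    (fun x => coeffAt x.1 x.2) S (injOn_handicapKey hρ hA p₀).injOn ?_ ?_
  · rw [← hS]
    simp only [finrank_bot, add_zero] at this
    exact this.trans ((finrank_restrictTotalDegree (F := F) _ N).trans_le (ncard_degree_le k N))
  · intro x hx
    simp only [S, Finset.mem_map, Finset.mem_sigma, Finset.mem_attach, true_and,
      Set.Finite.mem_toFinset] at hx
    obtain ⟨⟨⟨t, ht⟩, m⟩, ⟨h, hN, hm, hlt⟩, he⟩ := hx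
    obtain rfl : x = (⟨t, hQ t ht⟩, m) := he.symm
    refine ⟨shift (-t) h, ?_, ?_, ?_⟩
    · rw [mem_restrictTotalDegree]
      exact (totalDegree_shift_le _ _).trans hN
    · simpa [coeffAt_apply, shift_shift] using hm
    · rintro ⟨⟨t', ht'⟩, m'⟩ hkey
      simp only at hkey ht' ⊢
      have hp : p₀ + A t + A (t' - t) = p₀ + A t' := by simp
      rw [coeffAt_apply, shift_shift, ← sub_eq_add_neg]
      refine hlt (t' - t) (by rwa [hp]) m' (by rwa [hp])
  · rintro x - h hh -
    rw [(Submodule.mem_bot F).mp hh, map_zero]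

/-- Witnesses of the pivots gained are independent modulo polynomials of degree at most `N`, so the
gain is at most a difference of dimensions. -/
theorem ncard_pivots_add_le (hρ : Set.InjOn ρ P) (hA : Function.Injective A) (hk : 1 ≤ k)
    (hp : p ∈ P) (M : ℕ) :
    (pivots P ρ α (N + M) A p).ncard
      ≤ (pivots P ρ α N A p).ncard + M * (N + M + 1) ^ (k - 1) := by
  classical
  have hfin := (finite_pivots P ρ α (N + M) A p).subset
    (Set.sdiff_subset (t := pivots P ρ α N A p))
  let S : Finset ({t // p + A t ∈ P} × (Fin k →₀ ℕ)) :=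
    hfin.toFinset.map ⟨fun m => (⟨0, by simpa using hp⟩, m), fun m m' he => by simpa using he⟩
  have hle : restrictTotalDegree (Fin k) F N ≤ restrictTotalDegree (Fin k) F (N + M) := by
    intro h hh
    rw [mem_restrictTotalDegree] at hh ⊢
    omega
  have := card_pivots_add_finrank_le (restrictTotalDegree (Fin k) F N)
    (restrictTotalDegree (Fin k) F (N + M)) hle
    (fun x : {t // p + A t ∈ P} × (Fin k →₀ ℕ) => handicapKey α ρ (p + A x.1) x.2)
    (fun x => coeffAt x.1 x.2) S (injOn_handicapKey hρ hA p).injOn ?_ ?_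
  · rw [Finset.card_map, ← Set.ncard_eq_toFinset_card _ hfin, finrank_restrictTotalDegree,
      finrank_restrictTotalDegree] at this
    have h2 := ncard_degree_le_add k N M hk
    have h3 := Set.ncard_le_ncard_sdiff_add_ncard (pivots P ρ α (N + M) A p) (pivots P ρ α N A p)
      (finite_pivots P ρ α N A p)
    omega
  · intro x hx
    simp only [S, Finset.mem_map, Set.Finite.mem_toFinset] at hx
    obtain ⟨m, ⟨⟨h, hN, hm, hlt⟩, -⟩, he⟩ := hx
    obtain rfl : x = (⟨0, by simpa using hp⟩, m) := he.symm
    refine ⟨h, (mem_restrictTotalDegree _ _ _).mpr hN, by simpa [coeffAt_apply] using hm, ?_⟩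
    rintro ⟨⟨t', ht'⟩, m'⟩ hkey
    exact hlt t' ht' m' (by simpa using hkey)
  · intro x hx h hh hlt
    simp only [S, Finset.mem_map, Set.Finite.mem_toFinset] at hx
    obtain ⟨m, ⟨-, hm⟩, he⟩ := hx
    obtain rfl : x = (⟨0, by simpa using hp⟩, m) := he.symm
    by_contra hne
    refine hm ⟨h, (mem_restrictTotalDegree _ _ _).mp hh, by simpa [coeffAt_apply] using hne, ?_⟩
    intro t ht m' hkey
    exact hlt ⟨⟨t, ht⟩, m'⟩ (by simpa using hkey)

-- Raising the handicap of `p` moves conditions at `p` earlier, so a pivot at `q` has more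
-- conditions to meet.
open Classical in
theorem pivots_update_subset_of_ne {q : Fin n → F} (hq : q ≠ p) :
    pivots P ρ (Function.update α p (α p + 1)) N A q ⊆ pivots P ρ α N A q := by
  rintro m ⟨h, hN, hm, hlt⟩
  refine ⟨h, hN, hm, fun t ht m' hkey => hlt t ht m' ?_⟩
  rw [handicapKey_lt_iff] at hkey ⊢
  rw [Function.update_of_ne hq]
  by_cases hp : q + A t = p
  · rw [hp] at hkey ⊢
    rw [Function.update_self]
    omega
  · rwa [Function.update_of_ne hp]

/-- A polynomial of degree at most one with constant term `1` at the origin, which vanishes at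
all `t ≠ 0` with `A t = q`. -/
theorem exists_linear_form (hA : Function.Injective A) (q : Fin n → F) :
    ∃ l : MvPolynomial (Fin k) F, l.totalDegree ≤ 1 ∧ l - 1 ∈ idealOfVars (Fin k) F ∧
      ∀ t ≠ 0, A t = q → shift t l ∈ idealOfVars (Fin k) F := by
  by_cases hq : ∃ t ≠ 0, A t = q
  · obtain ⟨t, ht, rfl⟩ := hq
    obtain ⟨i, hi⟩ := Function.ne_iff.mp ht
    refine ⟨1 - C (t i)⁻¹ * X i, ?_, ?_, ?_⟩
    · refine (totalDegree_sub _ _).trans (max_le (by simp) ((totalDegree_mul _ _).trans ?_))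
      simp
    · rw [sub_sub_cancel_left, neg_mem_iff]
      exact Ideal.mul_mem_left _ _ (Ideal.subset_span ⟨i, rfl⟩)
    · intro t' _ he
      obtain rfl := hA he
      have : shift t' (1 - C (t' i)⁻¹ * X i) = -(C (t' i)⁻¹ * X i) := by
        have hC : C (t' i)⁻¹ * C (t' i) = (1 : MvPolynomial (Fin k) F) := by
          rw [← C_mul, inv_mul_cancel₀ hi, C_1]
        rw [map_sub, map_one, map_mul, shift_C, shift_X, mul_add, hC]
        ring
      rw [this, neg_mem_iff]
      exact Ideal.mul_mem_left _ _ (Ideal.subset_span ⟨i, rfl⟩)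
  · exact ⟨1, by simp, by simp, fun t ht he => (hq ⟨t, ht, he⟩).elim⟩

theorem prod_sub_one_mem {R ι : Type*} [CommRing R] (I : Ideal R) (s : Finset ι) (f : ι → R)
    (hf : ∀ i ∈ s, f i - 1 ∈ I) : ∏ i ∈ s, f i - 1 ∈ I := by
  rw [← Ideal.Quotient.eq, map_prod, map_one]
  exact Finset.prod_eq_one fun i hi => by
    rw [← map_one (Ideal.Quotient.mk I), Ideal.Quotient.eq]
    exact hf i hi

-- Raising the handicap by one costs a witness one order of vanishing at the other points.
-- Multiplying by one linear form for each point of `P` restores it without changing the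
-- lowest-order part at `p`; the degree grows by at most `P.card`.
open Classical in
theorem pivots_update_self_subset (hρ : Set.InjOn ρ P) (hA : Function.Injective A) (hp : p ∈ P) :
    pivots P ρ (Function.update α p (α p + 1)) N A p ⊆ pivots P ρ α (N + P.card) A p := by
  rintro m ⟨h, hN, hm, hlt⟩
  choose l hl1 hl2 hl3 using exists_linear_form (A := A) hA
  let u := ∏ q ∈ P, l (q - p)
  have hu : u - 1 ∈ idealOfVars (Fin k) F := prod_sub_one_mem _ _ _ fun q _ => hl2 _
  have hord : h ∈ idealOfVars (Fin k) F ^ m.degree := by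
    rw [mem_pow_idealOfVars_iff']
    intro m' hm'
    have := hlt 0 (by simpa using hp) m' (by
      rw [map_zero, add_zero, handicapKey_lt_iff]
      omega)
    simpa using this
  have hcoeff : ∀ m' : Fin k →₀ ℕ, m'.degree ≤ m.degree → coeff m' (h * u) = coeff m' h :=
    fun m' hm' => coeff_mul_of_mem_pow_idealOfVars (Ideal.pow_le_pow_right hm' hord) hu
  refine ⟨h * u, ?_, by rwa [hcoeff m le_rfl], ?_⟩
  · refine (totalDegree_mul _ _).trans (add_le_add hN ((totalDegree_finsetProd _ _).trans ?_))
    refine (Finset.sum_le_card_nsmul _ _ 1 fun q _ => hl1 _).trans ?_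
    simp
  · intro t ht m' hkey
    by_cases ht0 : t = 0
    · subst ht0
      rw [map_zero, add_zero] at hkey
      rw [shift_zero, hcoeff m' (by rw [handicapKey_lt_iff] at hkey; omega)]
      have := hlt 0 ht m' (by
        rw [map_zero, add_zero]
        rw [handicapKey_lt_iff] at hkey ⊢
        omega)
      simpa using this
    · have hne : p + A t ≠ p := by
        intro he
        rw [add_eq_left, ← map_zero A] at he
        exact ht0 (hA he)
      have hρne : ρ (p + A t) ≠ ρ p := fun he => hne (hρ ht hp he)
      have h1 : shift t h ∈ idealOfVars (Fin k) F ^ m'.degree := by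
        rw [mem_pow_idealOfVars_iff']
        intro m'' hm''
        refine hlt t ht m'' ?_
        rw [handicapKey_lt_iff] at hkey ⊢
        rw [Function.update_self, Function.update_of_ne hne]
        omega
      have h2 : shift t u ∈ idealOfVars (Fin k) F := by
        rw [map_prod]
        exact Ideal.prod_mem _ ht (hl3 _ t ht0 (by simp))
      have h3 : shift t (h * u) ∈ idealOfVars (Fin k) F ^ (m'.degree + 1) := by
        rw [map_mul, pow_succ]
        exact Ideal.mul_mem_mul h1 h2
      exact (mem_pow_idealOfVars_iff' _ _).mp h3 m' (Nat.lt_succ_self _)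

end pivots

/-! ### Leading exponents and the lower bound for joint pivots -/

section vanishing

open MvPolynomial

variable {F : Type*} [Field F] {n d : ℕ} {k : Fin d → ℕ} {P Q : Finset (Fin n → F)}
  {ρ α : (Fin n → F) → ℕ} {N : ℕ}

theorem degree_sigmaFinsuppEquivPiFinsupp_symm (f : ∀ j, Fin (k j) →₀ ℕ) :
    (Finsupp.sigmaFinsuppEquivPiFinsupp.symm f).degree = ∑ j, (f j).degree := by
  simp only [Finsupp.degree_eq_sum, Fintype.sum_sigma]
  rfl

/-- The leading exponent of a polynomial, at the point where its order of vanishing has the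
highest priority and in coordinates adapted to a decomposition of the space, is made up of
pivots along the summands. -/
theorem exists_pivots_coeff_ne_zero (hρ : Set.InjOn ρ P) (hQP : Q ⊆ P) (hQ : Q.Nonempty)
    (hgap : ∀ q ∈ Q, ∀ r ∈ P, r ∉ Q → α r + N < α q)
    (A : (Fin n → F) → ∀ j, (Fin (k j) → F) →ₗ[F] (Fin n → F))
    (B : (Fin n → F) → ((Σ j, Fin (k j)) → F) ≃ₗ[F] (Fin n → F))
    (hB : ∀ p y, B p y = ∑ j, A p j fun i => y ⟨j, i⟩)
    {g : MvPolynomial (Fin n) F} (hg : g ≠ 0) (hgN : g.totalDegree ≤ N) :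
    ∃ p ∈ Q, ∃ M : ∀ j, Fin (k j) →₀ ℕ, (∀ j, M j ∈ pivots P ρ α N (A p j) p) ∧
      coeff (Finsupp.sigmaFinsuppEquivPiFinsupp.symm M)
        (linSubst (B p).toLinearMap (shift p g)) ≠ 0 := by
  classical
  have hne : ∀ p, shift p g ≠ 0 := fun p h0 => hg <| by
    rw [← shift_zero g, ← neg_add_cancel p, ← shift_shift, h0, map_zero]
  choose r hrN hr hr' using fun p => exists_order (hne p)
  replace hrN : ∀ p, r p ≤ N := fun p => (hrN p).trans ((totalDegree_shift_le _ _).trans hgN)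
  obtain ⟨p, hp, hmin⟩ := P.exists_min_image (fun p => toLex ((r p : ℤ) - α p, ρ p))
    (hQ.mono hQP)
  replace hmin : ∀ q ∈ P, r p + α q < r q + α p ∨ r p + α q = r q + α p ∧ ρ p ≤ ρ q := by
    intro q hq
    have := hmin q hq
    rw [Prod.Lex.toLex_le_toLex] at this
    simp only at this
    omega
  -- Orders of vanishing lie in `[0, N]`, so a handicap gap larger than `N` excludes points outside
  -- `Q`.
  have hpQ : p ∈ Q := by
    by_contra hpQ
    obtain ⟨q, hq⟩ := hQ
    have h1 := hgap q hq p hp hpQ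
    have h2 := hmin q (hQP hq)
    have h3 := hrN q
    omega
  set G := linSubst (B p).toLinearMap (shift p g) with hG
  have hGr : G ∈ idealOfVars _ F ^ r p := linSubst_mem_pow_idealOfVars _ (hr p)
  have hGr' : G ∉ idealOfVars _ F ^ (r p + 1) := fun h => hr' p <| by
    rw [← linSubst_linSubst_symm (B p) (shift p g)]
    exact linSubst_mem_pow_idealOfVars _ h
  have hGN : G.totalDegree ≤ N :=
    (totalDegree_linSubst_le _ _).trans ((totalDegree_shift_le _ _).trans hgN)
  have hex : (G.support.filter fun m => m.degree = r p).Nonempty := by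
    rw [mem_pow_idealOfVars_iff'] at hGr hGr'
    push Not at hGr'
    obtain ⟨m, hm, hm0⟩ := hGr'
    refine ⟨m, Finset.mem_filter.mpr ⟨mem_support_iff.mpr hm0, ?_⟩⟩
    by_contra hne
    exact hm0 (hGr m (by omega))
  -- Minimality of the sum of the codes makes each block of the exponent minimal when the other
  -- blocks are fixed.
  obtain ⟨M', hM', hMmin⟩ := Finset.exists_min_image _
    (fun m => ∑ j, Encodable.encode (Finsupp.sigmaFinsuppEquivPiFinsupp m j)) hex
  obtain ⟨M, rfl⟩ := Finsupp.sigmaFinsuppEquivPiFinsupp.symm.surjective M'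
  rw [Finset.mem_filter, mem_support_iff] at hM'
  obtain ⟨hM0, hMr⟩ := hM'
  simp only [Equiv.apply_symm_apply, Finset.mem_filter, mem_support_iff, and_imp] at hMmin
  refine ⟨p, hpQ, M, fun j => ?_, hM0⟩
  have hinj : Function.Injective fun i : Fin (k j) => (⟨j, i⟩ : Σ j, Fin (k j)) :=
    fun a b h => by simpa using h
  -- The witness for `M j` is the slice of `G` whose exponents in the other blocks are those of `M`.
  obtain ⟨E, hE, hEshift⟩ := exists_slice (F := F) _ hinj
    (fun m => Finsupp.sigmaFinsuppEquivPiFinsupp.symm (Function.update M j m))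
    (fun m i => by
      change (Function.update M j m j) i = m i
      rw [Function.update_self])
    (fun m m' s hs => by
      have hsj : s.1 ≠ j := by
        rintro rfl
        exact hs ⟨s.2, rfl⟩
      change (Function.update M j m s.1) s.2 = (Function.update M j m' s.1) s.2
      rw [Function.update_of_ne hsj, Function.update_of_ne hsj])
  have hdeg : ∀ m, (Finsupp.sigmaFinsuppEquivPiFinsupp.symm (Function.update M j m)).degree
      + (M j).degree = m.degree + r p := by
    intro m
    rw [← hMr, degree_sigmaFinsuppEquivPiFinsupp_symm, degree_sigmaFinsuppEquivPiFinsupp_symm,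
      ← Finset.add_sum_erase _ _ (Finset.mem_univ j),
      ← Finset.add_sum_erase _ (fun j => (M j).degree) (Finset.mem_univ j), Function.update_self,
      Finset.sum_congr rfl fun i hi => by rw [Function.update_of_ne (Finset.ne_of_mem_erase hi)]]
    ring
  have hMj : (M j).degree ≤ r p := by
    rw [← hMr, degree_sigmaFinsuppEquivPiFinsupp_symm]
    exact Finset.single_le_sum (f := fun j => (M j).degree) (fun _ _ => Nat.zero_le _)
      (Finset.mem_univ j)
  refine ⟨E G, ?_, by rwa [hE, Function.update_eq_self], ?_⟩
  · refine Finset.sup_le fun m hm => ?_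
    rw [mem_support_iff, hE] at hm
    have h1 := (le_totalDegree (mem_support_iff.mpr hm)).trans hGN
    change Finsupp.degree _ ≤ N at h1
    have h2 := hdeg m
    change m.degree ≤ N
    omega
  · intro t ht m' hkey
    rw [handicapKey_lt_iff] at hkey
    have hBu : B p (fun s => Function.update (0 : ∀ j, Fin (k j) → F) j t s.1 s.2)
        = A p j t := by
      rw [hB, Finset.sum_eq_single j]
      · simp
      · intro i _ hi
        simp only [Function.update_of_ne hi]
        exact map_zero _
      · simp
    -- Earlier conditions at `p` in the same degree follow from the minimality of the code; all
    -- others follow from the orders of vanishing of `g`.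
    by_cases hsame : (m'.degree = (M j).degree ∧ A p j t = 0) ∧
        Encodable.encode m' < Encodable.encode (M j)
    · obtain ⟨⟨hd, ht0⟩, henc⟩ := hsame
      have ht0 : t = 0 := by
        have h1 := hBu.trans ht0
        rw [LinearEquiv.map_eq_zero_iff] at h1
        ext i
        simpa using congrFun h1 ⟨j, i⟩
      subst ht0
      rw [shift_zero, hE]
      by_contra hc
      have h1 := hMmin _ hc (by have := hdeg m'; omega)
      simp only [Equiv.apply_symm_apply] at h1
      rw [← Finset.add_sum_erase _ _ (Finset.mem_univ j),
        ← Finset.add_sum_erase _ (fun i => Encodable.encode (Function.update M j m' i))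
          (Finset.mem_univ j), Function.update_self] at h1
      have h2 : ∑ i ∈ Finset.univ.erase j, Encodable.encode (Function.update M j m' i)
          = ∑ i ∈ Finset.univ.erase j, Encodable.encode (M i) :=
        Finset.sum_congr rfl fun i hi => by
          rw [Function.update_of_ne (Finset.ne_of_mem_erase hi)]
      omega
    · rw [← hEshift t (fun s => Function.update (0 : ∀ j, Fin (k j) → F) j t s.1 s.2)
        (fun i => by simp) (fun s hs => by
          have hsj : s.1 ≠ j := by
            rintro rfl
            exact hs ⟨s.2, rfl⟩
          simp [Function.update_of_ne hsj]), hE, hG, shift_linSubst, shift_shift]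
      rw [LinearEquiv.coe_coe, hBu, add_comm]
      have h1 := linSubst_mem_pow_idealOfVars (B p).toLinearMap (hr (p + A p j t))
      rw [mem_pow_idealOfVars_iff'] at h1
      refine h1 _ ?_
      have h2 := hdeg m'
      have h3 := hmin _ ht
      rcases hkey with hkey | ⟨hkey, hkey' | ⟨hkey', henc⟩⟩
      · omega
      · omega
      · have : p + A p j t = p := hρ ht hp hkey'
        rw [this] at hkey
        exact (hsame ⟨⟨by omega, by simpa using this⟩, henc⟩).elim

/-- A polynomial of degree at most `n * T` is determined by its coefficients at the joint pivots of
points of `Q`. -/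
theorem pow_le_sum_prod_ncard_pivots {T : ℕ} (hρ : Set.InjOn ρ P) (hQP : Q ⊆ P)
    (hQ : Q.Nonempty) (hgap : ∀ q ∈ Q, ∀ r ∈ P, r ∉ Q → α r + n * T < α q)
    (A : (Fin n → F) → ∀ j, (Fin (k j) → F) →ₗ[F] (Fin n → F))
    (B : (Fin n → F) → ((Σ j, Fin (k j)) → F) ≃ₗ[F] (Fin n → F))
    (hB : ∀ p y, B p y = ∑ j, A p j fun i => y ⟨j, i⟩) :
    (T + 1) ^ n ≤ ∑ p ∈ Q, ∏ j, (pivots P ρ α (n * T) (A p j) p).ncard := by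
  classical
  let S : Finset (Σ _ : Fin n → F, ∀ j, Fin (k j) →₀ ℕ) := Q.sigma fun p =>
    Fintype.piFinset fun j => (finite_pivots P ρ α (n * T) (A p j) p).toFinset
  have hS : S.card = ∑ p ∈ Q, ∏ j, (pivots P ρ α (n * T) (A p j) p).ncard := by
    rw [Finset.card_sigma]
    refine Finset.sum_congr rfl fun p _ => ?_
    rw [Fintype.card_piFinset]
    exact Finset.prod_congr rfl fun j _ => (Set.ncard_eq_toFinset_card _ _).symm
  let Φ : restrictTotalDegree (Fin n) F (n * T) →ₗ[F] (S → F) :=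
    (LinearMap.pi fun x : S =>
      (lcoeff F (Finsupp.sigmaFinsuppEquivPiFinsupp.symm x.1.2)).comp
        ((linSubst (B x.1.1).toLinearMap).toLinearMap.comp (shift x.1.1).toLinearMap)).comp
      (Submodule.subtype _)
  have hΦ : Function.Injective Φ := by
    rw [injective_iff_map_eq_zero]
    rintro ⟨g, hg⟩ h0
    by_contra hne
    obtain ⟨p, hp, M, hM, hc⟩ := exists_pivots_coeff_ne_zero hρ hQP hQ hgap A B hB
      (g := g) (fun h => hne (by simpa using h)) ((mem_restrictTotalDegree _ _ _).mp hg)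
    exact hc (congrFun h0 ⟨⟨p, M⟩, by simpa [S] using ⟨hp, hM⟩⟩)
  have := LinearMap.finrank_le_finrank_of_injective hΦ
  rw [finrank_restrictTotalDegree, Module.finrank_fintype_fun_eq_card, Fintype.card_coe, hS] at this
  exact (pow_le_ncard_degree_le n T).trans this

end vanishing

/-! ### Tuning the handicaps -/

/-- Raising one at a time the handicaps of points `p` with `W α p < τ p` terminates: otherwise a
set of raised points would have handicaps far above all the others. -/
theorem exists_handicap {ι : Type*} [DecidableEq ι] (P : Finset ι) (W : (ι → ℕ) → ι → ℕ)
    (τ : ι → ℝ) (L D : ℝ) (N : ℕ)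
    (hmono : ∀ α p q, q ≠ p → W (Function.update α p (α p + 1)) q ≤ W α q)
    (hlip : ∀ α, ∀ p ∈ P, (W (Function.update α p (α p + 1)) p : ℝ) ≤ W α p + L)
    (hgap : ∀ α Q, Q ⊆ P → Q.Nonempty → (∀ q ∈ Q, ∀ r ∈ P, r ∉ Q → α r + N < α q) →
      D ≤ ∑ q ∈ Q, (W α q : ℝ))
    (hτ : ∀ p ∈ P, 0 ≤ τ p + L) (hsmall : ∑ p ∈ P, (τ p + L) < D) :
    ∃ α, ∀ p ∈ P, τ p ≤ W α p := by
  by_contra! hcon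
  have hraise : ∀ s : ℕ, ∃ α : ι → ℕ, (∀ p ∈ P, 0 < α p → (W α p : ℝ) ≤ τ p + L) ∧
      s ≤ ∑ p ∈ P, α p := by
    intro s
    induction s with
    | zero => exact ⟨0, by simp, by simp⟩
    | succ s ih =>
      obtain ⟨α, hα, hs⟩ := ih
      obtain ⟨p, hp, hlt⟩ := hcon α
      refine ⟨Function.update α p (α p + 1), fun q hq hq0 => ?_, ?_⟩
      · by_cases hqp : q = p
        · subst hqp
          exact (hlip α q hp).trans (by linarith)
        · rw [Function.update_of_ne hqp] at hq0
          exact le_trans (by exact_mod_cast hmono α p q hqp) (hα q hq hq0)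
      · rw [Finset.sum_update_of_mem hp]
        rw [← Finset.add_sum_erase _ _ hp] at hs
        rw [Finset.sdiff_singleton_eq_erase]
        omega
  have hbound : ∀ α : ι → ℕ, (∀ p ∈ P, 0 < α p → (W α p : ℝ) ≤ τ p + L) →
      ∀ p ∈ P, α p ≤ (P.card + 1) * (N + 1) := by
    intro α hα p hp
    by_contra! hlt
    -- There are `P.card + 1` windows of length `N + 1` and only `P.card` points, so some window
    -- contains no handicap. A zero handicap is counted in window `0` by truncated subtraction,
    -- which is harmless.
    obtain ⟨i, hi, hi'⟩ := Finset.exists_mem_notMem_of_card_lt_card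
      (s := P.image fun q => (α q - 1) / (N + 1)) (t := Finset.range (P.card + 1))
      (by rw [Finset.card_range]; exact Nat.lt_succ_of_le Finset.card_image_le)
    rw [Finset.mem_range] at hi
    have hwin : ∀ q ∈ P, α q ≤ i * (N + 1) ∨ (i + 1) * (N + 1) < α q := by
      intro q hq
      rcases Nat.eq_zero_or_pos (α q) with h0 | h0
      · left
        omega
      · rcases lt_trichotomy ((α q - 1) / (N + 1)) i with h | h | h
        · rw [Nat.div_lt_iff_lt_mul N.add_one_pos] at h
          left
          omega
        · exact (hi' (Finset.mem_image.mpr ⟨q, hq, h⟩)).elim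
        · have h' : (i + 1) * (N + 1) ≤ α q - 1 := (Nat.le_div_iff_mul_le N.add_one_pos).mp h
          right
          omega
    -- All points above the empty window have been raised, so their weights are at most `τ + L`, too
    -- small for `hgap`.
    have hQ := hgap α (P.filter fun q => (i + 1) * (N + 1) < α q) (Finset.filter_subset _ _)
      ⟨p, Finset.mem_filter.mpr
        ⟨hp, lt_of_le_of_lt (Nat.mul_le_mul_right _ (by omega)) hlt⟩⟩ ?_
    · have h1 : ∑ q ∈ P.filter (fun q => (i + 1) * (N + 1) < α q), (W α q : ℝ)
          ≤ ∑ q ∈ P, (τ q + L) :=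
        (Finset.sum_le_sum fun q hq => hα q (Finset.mem_filter.mp hq).1
          (lt_of_le_of_lt (Nat.zero_le _) (Finset.mem_filter.mp hq).2)).trans
        (Finset.sum_le_sum_of_subset_of_nonneg (Finset.filter_subset _ _) fun q hq _ => hτ q hq)
      linarith
    · intro q hq r hr hrQ
      rw [Finset.mem_filter] at hq hrQ
      have h1 := (hwin r hr).resolve_right fun h => hrQ ⟨hr, h⟩
      have h2 := hq.2
      rw [add_one_mul] at h2
      omega
  obtain ⟨α, hα, hs⟩ := hraise (P.card * ((P.card + 1) * (N + 1)) + 1)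
  have : ∑ p ∈ P, α p ≤ _ := Finset.sum_le_card_nsmul P α _ (hbound α hα)
  rw [smul_eq_mul] at this
  omega

/-- Each factor is perturbed by one power of `R` less than its size; the outer factor `R` avoids the
exponent `k i - 1`. The induction uses `1 + 2 * 3 ^ s.card ≤ 3 ^ (s.card + 1)`. -/
theorem mul_prod_add_le {ι : Type*} (s : Finset ι) (b δ k : ι → ℕ) {R M : ℕ} (hR : 0 < R)
    (hMR : M ≤ R) (hb : ∀ i ∈ s, b i ≤ R ^ k i) (hδ : ∀ i ∈ s, δ i * R ≤ M * R ^ k i) :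
    R * ∏ i ∈ s, (b i + δ i) ≤ R * ∏ i ∈ s, b i + 3 ^ s.card * M * R ^ ∑ i ∈ s, k i := by
  classical
  induction s using Finset.induction_on with
  | empty => simp
  | insert a s ha ih =>
    have ih := ih (fun i hi => hb i (Finset.mem_insert_of_mem hi))
      (fun i hi => hδ i (Finset.mem_insert_of_mem hi))
    have hba := hb a (Finset.mem_insert_self a s)
    have hδa := hδ a (Finset.mem_insert_self a s)
    have hδa' : δ a ≤ R ^ k a := by
      refine Nat.le_of_mul_le_mul_right (hδa.trans ?_) hR
      rw [mul_comm]
      exact Nat.mul_le_mul_left _ hMR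
    have hprod : ∏ i ∈ s, b i ≤ R ^ ∑ i ∈ s, k i := by
      rw [← Finset.prod_pow_eq_pow_sum]
      exact Finset.prod_le_prod' fun i hi => hb i (Finset.mem_insert_of_mem hi)
    rw [Finset.prod_insert ha, Finset.prod_insert ha, Finset.sum_insert ha,
      Finset.card_insert_of_notMem ha]
    set K := ∑ i ∈ s, k i
    set X := ∏ i ∈ s, b i
    calc R * ((b a + δ a) * ∏ i ∈ s, (b i + δ i))
        = (b a + δ a) * (R * ∏ i ∈ s, (b i + δ i)) := by ring
      _ ≤ (b a + δ a) * (R * X + 3 ^ s.card * M * R ^ K) := Nat.mul_le_mul_left _ ih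
      _ = R * (b a * X) + (δ a * R) * X + (b a + δ a) * (3 ^ s.card * M * R ^ K) := by ring
      _ ≤ R * (b a * X) + (M * R ^ k a) * R ^ K
          + (R ^ k a + R ^ k a) * (3 ^ s.card * M * R ^ K) := by gcongr
      _ = R * (b a * X) + (1 + 2 * 3 ^ s.card) * (M * (R ^ k a * R ^ K)) := by ring
      _ ≤ R * (b a * X) + (3 ^ s.card * 3) * (M * (R ^ k a * R ^ K)) := by
        have := Nat.one_le_pow s.card 3 (by norm_num)
        gcongr
        omega
      _ = R * (b a * X) + 3 ^ (s.card + 1) * M * R ^ (k a + K) := by ring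

/-! ### Parametrizations of subspaces and affine planes -/

section planes

variable {F : Type*} [Field F] {n : ℕ}

/-- A linear parametrization of a `k`-dimensional subspace. -/
noncomputable def Gr.param {m : ℕ} (V : Gr m F n) : (Fin m → F) →ₗ[F] (Fin n → F) :=
  V.1.subtype ∘ₗ (Module.finBasisOfFinrankEq F V.1 V.2).equivFun.symm.toLinearMap

theorem Gr.param_injective {m : ℕ} (V : Gr m F n) : Function.Injective V.param :=
  V.1.injective_subtype.comp (LinearEquiv.injective _)

theorem Gr.range_param {m : ℕ} (V : Gr m F n) : LinearMap.range V.param = V.1 := by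
  rw [Gr.param, LinearMap.range_comp_of_range_eq_top _ (LinearEquiv.range _),
    Submodule.range_subtype]

theorem Gr.exists_linearEquiv {d : ℕ} {k : Fin d → ℕ} (hk : ∑ j, k j = n)
    (V : ∀ j, Gr (k j) F n) (hV : ⨆ j, (V j).1 = ⊤) :
    ∃ B : ((Σ j, Fin (k j)) → F) ≃ₗ[F] (Fin n → F),
      ∀ y, B y = ∑ j, (V j).param fun i => y ⟨j, i⟩ := by
  classical
  let B : ((Σ j, Fin (k j)) → F) →ₗ[F] (Fin n → F) :=
    ∑ j, (V j).param ∘ₗ LinearMap.funLeft F F fun i => ⟨j, i⟩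
  have hB : ∀ y, B y = ∑ j, (V j).param fun i => y ⟨j, i⟩ := by
    intro y
    simp only [B, LinearMap.sum_apply]
    rfl
  have hsurj : Function.Surjective B := by
    rw [← LinearMap.range_eq_top, eq_top_iff, ← hV, iSup_le_iff]
    intro j
    rw [← Gr.range_param]
    rintro _ ⟨t, rfl⟩
    refine ⟨fun s => Function.update (0 : ∀ j, Fin (k j) → F) j t s.1 s.2, ?_⟩
    rw [hB, Finset.sum_eq_single j]
    · simp
    · intro i _ hi
      simp only [Function.update_of_ne hi]
      exact map_zero _
    · simp
  have hdim : Module.finrank F ((Σ j, Fin (k j)) → F) = Module.finrank F (Fin n → F) := by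
    simp [hk]
  exact ⟨LinearEquiv.ofBijective B
    ⟨(LinearMap.injective_iff_surjective_of_finrank_eq_finrank hdim).mpr hsurj, hsurj⟩, hB⟩

/-- The affine plane through `p₀` is parametrized by its direction. -/
theorem AffinePlane.tsum_eq {m : ℕ} (π : AffinePlane m F n) {p₀ : Fin n → F} (hp₀ : p₀ ∈ π.1)
    (f : (Fin n → F) → ℝ≥0∞) : ∑' p : π.1, f p = ∑' t, f (p₀ + π.e.param t) := by
  have hmem : ∀ t, p₀ + π.e.param t ∈ π.1 := fun t => by
    rw [add_comm]
    refine AffineSubspace.vadd_mem_of_mem_direction (s := π.1) ?_ hp₀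
    change _ ∈ π.e.1
    rw [← Gr.range_param]
    exact ⟨t, rfl⟩
  have hbij : Function.Bijective fun t => (⟨p₀ + π.e.param t, hmem t⟩ : π.1) := by
    refine ⟨fun t t' h => π.e.param_injective (add_left_cancel (Subtype.ext_iff.mp h)), ?_⟩
    rintro ⟨p, hp⟩
    have h1 : p - p₀ ∈ π.e.1 := AffineSubspace.vsub_mem_direction hp hp₀
    rw [← Gr.range_param] at h1
    obtain ⟨t, ht⟩ := h1
    exact ⟨t, Subtype.ext (by simp [ht])⟩
  exact ((Equiv.ofBijective _ hbij).tsum_eq fun p : π.1 => f p).symm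

end planes

theorem exists_injOn_nat {E : Type*} (P : Finset E) : ∃ ρ : E → ℕ, Set.InjOn ρ P := by
  classical
  refine ⟨fun p => P.toList.idxOf p, fun p hp q _ he => ?_⟩
  exact (List.idxOf_inj (Finset.mem_toList.mpr hp)).mp he

/-! ### Minimal joint pivot counts and the factorisation -/

section factorisation

variable {F : Type*} [Field F] {n d : ℕ} {k : Fin d → ℕ}

/-- The least number of joint pivots at `p`, over all families of planes through `p` which span. -/
noncomputable def minPivots (k : Fin d → ℕ) (P : Finset (Fin n → F)) (ρ : (Fin n → F) → ℕ) (N : ℕ)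
    (α : (Fin n → F) → ℕ) (p : Fin n → F) : ℕ :=
  sInf {x | ∃ V : ∀ j, Gr (k j) F n, ⨆ j, (V j).1 = ⊤ ∧
    x = ∏ j, (pivots P ρ α N (V j).param p).ncard}

theorem minPivots_le (P : Finset (Fin n → F)) (ρ : (Fin n → F) → ℕ) (N : ℕ)
    (α : (Fin n → F) → ℕ) (p : Fin n → F) {V : ∀ j, Gr (k j) F n} (hV : ⨆ j, (V j).1 = ⊤) :
    minPivots k P ρ N α p ≤ ∏ j, (pivots P ρ α N (V j).param p).ncard :=
  Nat.sInf_le ⟨V, hV, rfl⟩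

theorem exists_minPivots_eq (hV : ∃ V : ∀ j, Gr (k j) F n, ⨆ j, (V j).1 = ⊤)
    (P : Finset (Fin n → F)) (ρ : (Fin n → F) → ℕ) (N : ℕ) (α : (Fin n → F) → ℕ)
    (p : Fin n → F) : ∃ V : ∀ j, Gr (k j) F n, ⨆ j, (V j).1 = ⊤ ∧
      minPivots k P ρ N α p = ∏ j, (pivots P ρ α N (V j).param p).ncard := by
  obtain ⟨V, hV⟩ := hV
  exact Nat.sInf_mem (s := {x | ∃ V : ∀ j, Gr (k j) F n, ⨆ j, (V j).1 = ⊤ ∧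
    x = ∏ j, (pivots P ρ α N (V j).param p).ncard}) ⟨_, V, hV, rfl⟩

-- The family minimising the old product is tested against the new handicap; each of its factors
-- grows by a lower-order term.
open Classical in
theorem minPivots_update_le {P : Finset (Fin n → F)} {ρ : (Fin n → F) → ℕ} (hρ : Set.InjOn ρ P)
    (hV : ∃ V : ∀ j, Gr (k j) F n, ⨆ j, (V j).1 = ⊤) (hk : ∀ j, 1 ≤ k j) (hkn : ∑ j, k j = n)
    (hn : 1 ≤ n) (N : ℕ) (α : (Fin n → F) → ℕ) {p : Fin n → F} (hp : p ∈ P) :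
    minPivots k P ρ N (Function.update α p (α p + 1)) p
      ≤ minPivots k P ρ N α p + 3 ^ d * P.card * (N + P.card + 1) ^ (n - 1) := by
  obtain ⟨V, hV, hmin⟩ := exists_minPivots_eq hV P ρ N α p
  refine (minPivots_le P ρ N _ p hV).trans ?_
  set R := N + P.card + 1
  have hR : 0 < R := Nat.succ_pos _
  have h1 : ∀ j, (pivots P ρ (Function.update α p (α p + 1)) N (V j).param p).ncard
      ≤ (pivots P ρ α N (V j).param p).ncard + P.card * R ^ (k j - 1) := fun j =>
    (Set.ncard_le_ncard (pivots_update_self_subset hρ (V j).param_injective hp)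
      (finite_pivots _ _ _ _ _ _)).trans
      (ncard_pivots_add_le hρ (V j).param_injective (hk j) hp P.card)
  have h2 := mul_prod_add_le Finset.univ (fun j => (pivots P ρ α N (V j).param p).ncard)
    (fun j => P.card * R ^ (k j - 1)) k hR (M := P.card) (by omega)
    (fun j _ => (ncard_pivots_le P ρ α N _ p).trans (Nat.pow_le_pow_left (by omega) _))
    (fun j _ => by rw [mul_assoc, ← pow_succ, Nat.sub_add_cancel (hk j)])
  rw [hkn, Finset.card_univ, Fintype.card_fin, ← hmin] at h2
  refine (Finset.prod_le_prod' fun j _ => h1 j).trans (Nat.le_of_mul_le_mul_left ?_ hR)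
  refine h2.trans_eq ?_
  obtain ⟨n, rfl⟩ : ∃ m, n = m + 1 := ⟨n - 1, by omega⟩
  rw [Nat.add_sub_cancel]
  ring

/-- For a suitable degree and handicap, the number of joint pivots at each point of `P` is
bounded below by the prescribed weight. -/
theorem exists_handicap_minPivots (hV : ∃ V : ∀ j, Gr (k j) F n, ⨆ j, (V j).1 = ⊤)
    (hk : ∀ j, 1 ≤ k j) (hkn : ∑ j, k j = n) (hn : 1 ≤ n) {P : Finset (Fin n → F)}
    {ρ : (Fin n → F) → ℕ} (hρ : Set.InjOn ρ P) (w : (Fin n → F) → ℝ) (hw0 : ∀ p, 0 ≤ w p)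
    (hw : ∑ p ∈ P, w p ≤ 1) :
    ∃ (T : ℕ) (α : (Fin n → F) → ℕ), ∀ p ∈ P,
      w p * ((T + 1) ^ n / 2) ≤ minPivots k P ρ (n * T) α p := by
  classical
  set M := P.card with hM
  -- Since `n * T + M + 1 ≤ (n + M) * (T + 1)`, this `T` makes the total error `M * L` less than
  -- half of `(T + 1) ^ n`.
  obtain ⟨T, hT⟩ : ∃ T, T = 2 * M * (3 ^ d * M) * (n + M) ^ (n - 1) := ⟨_, rfl⟩
  refine ⟨T, exists_handicap P (minPivots k P ρ (n * T)) (fun p => w p * ((T + 1) ^ n / 2))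
    ((3 ^ d * M * (n * T + M + 1) ^ (n - 1) : ℕ) : ℝ) ((T + 1) ^ n) (n * T) ?_ ?_ ?_ ?_ ?_⟩
  · intro α p q hq
    obtain ⟨V, hV, hmin⟩ := exists_minPivots_eq hV P ρ (n * T) α q
    rw [hmin]
    refine (minPivots_le P ρ (n * T) _ q hV).trans (Finset.prod_le_prod' fun j _ => ?_)
    exact Set.ncard_le_ncard (pivots_update_subset_of_ne hq) (finite_pivots _ _ _ _ _ _)
  · intro α p hp
    exact_mod_cast minPivots_update_le hρ hV hk hkn hn (n * T) α hp
  · intro α Q hQP hQ hgap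
    choose V hV hmin using exists_minPivots_eq hV P ρ (n * T) α
    choose B hB using fun p => Gr.exists_linearEquiv hkn (V p) (hV p)
    have := pow_le_sum_prod_ncard_pivots hρ hQP hQ hgap (fun p j => (V p j).param) B hB
    simp only [← hmin] at this
    exact_mod_cast this
  · intro p _
    have := hw0 p
    positivity
  · rw [Finset.sum_add_distrib, ← Finset.sum_mul, Finset.sum_const, ← hM, nsmul_eq_mul]
    have h1 : 2 * (M * (3 ^ d * M * (n * T + M + 1) ^ (n - 1))) < (T + 1) ^ n := by
      have hR : n * T + M + 1 ≤ (n + M) * (T + 1) := by nlinarith [Nat.zero_le (M * T)]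
      calc 2 * (M * (3 ^ d * M * (n * T + M + 1) ^ (n - 1)))
          ≤ 2 * (M * (3 ^ d * M * ((n + M) * (T + 1)) ^ (n - 1))) := by gcongr
        _ = T * (T + 1) ^ (n - 1) := by
          rw [mul_pow]
          nth_rw 2 [hT]
          ring
        _ < (T + 1) * (T + 1) ^ (n - 1) := by
          gcongr
          omega
        _ = (T + 1) ^ n := by rw [← pow_succ', Nat.sub_add_cancel hn]
    have h2 : (2 : ℝ) * (M * ((3 ^ d * M * (n * T + M + 1) ^ (n - 1) : ℕ) : ℝ))
        < (T + 1) ^ n := by exact_mod_cast h1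
    have h3 : (∑ p ∈ P, w p) * (((T : ℝ) + 1) ^ n / 2) ≤ 1 * (((T : ℝ) + 1) ^ n / 2) := by
      gcongr
    linarith

open Classical in
theorem sum_pivots_affinePlane_le {m : ℕ} {P : Finset (Fin n → F)} {ρ : (Fin n → F) → ℕ}
    (hρ : Set.InjOn ρ P) (α : (Fin n → F) → ℕ) (N : ℕ) (π : AffinePlane m F n) :
    ∑' p : π.1, (((if (p : Fin n → F) ∈ P then
      ((pivots P ρ α N π.e.param p).ncard : ℝ≥0) / (N + 1) ^ m else 0 : ℝ≥0)) : ℝ≥0∞) ≤ 1 := by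
  obtain ⟨p₀, hp₀⟩ := π.2.1
  rw [π.tsum_eq hp₀ fun p => ((if p ∈ P then
      ((pivots P ρ α N π.e.param p).ncard : ℝ≥0) / (N + 1) ^ m else 0 : ℝ≥0) : ℝ≥0∞)]
  have hinj : Function.Injective fun t => p₀ + π.e.param t := fun t t' h =>
    π.e.param_injective (add_left_cancel h)
  let Q := P.preimage (fun t => p₀ + π.e.param t) hinj.injOn
  have hQ : ∀ t, t ∈ Q ↔ p₀ + π.e.param t ∈ P := fun t => Finset.mem_preimage
  rw [tsum_eq_sum (s := Q) fun t ht => by rw [if_neg (by rwa [hQ] at ht), ENNReal.coe_zero],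
    Finset.sum_congr rfl fun t ht => by rw [if_pos ((hQ t).mp ht)]]
  have h := sum_ncard_pivots_le (α := α) (N := N) hρ π.e.param_injective p₀ Q
    fun t ht => (hQ t).mp ht
  rw [← ENNReal.ofNNReal_finsetSum, ← Finset.sum_div, ENNReal.coe_le_one_iff]
  exact div_le_one_of_le₀ (by exact_mod_cast h) (by positivity)

end factorisation

theorem theorem1 (n : ℕ) :
    ∃ C : ℝ≥0, ∀ (F : Type*) [Field F] (d : ℕ) (k : Fin d → ℕ),
      1 ≤ d → (∀ j, 1 ≤ k j) → ∑ j, k j = n →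
      ∀ S : (Fin n → F) → ℝ≥0, S.support.Finite → discreteNorm d S = 1 →
        ∃ s : ∀ m : ℕ, (Fin n → F) → Gr m F n → ℝ≥0,
          (∀ (p : Fin n → F) (V : ∀ j, Gr (k j) F n),
            discreteWedge V * S p ^ d ≤ C * ∏ j, s (k j) p (V j)) ∧
          (∀ (j : Fin d) (π : AffinePlane (k j) F n),
            ∑' p : π.1, (s (k j) p π.e : ℝ≥0∞) ≤ 1) := by
  classical
  -- The `2` is the half lost in tuning the handicaps; `n ^ n` comes from `n * T + 1 ≤ n * (T + 1)`.
  refine ⟨2 * n ^ n, fun F _ d k hd hk hkn S hS hnorm => ?_⟩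
  by_cases hV : ∃ V : ∀ j, Gr (k j) F n, ⨆ j, (V j).1 = ⊤
  swap
  · refine ⟨fun _ _ _ => 0, fun p V => ?_, fun j π => by simp⟩
    rw [discreteWedge, if_neg fun h => hV ⟨V, h⟩, zero_mul]
    exact zero_le
  have hn : 1 ≤ n := by
    rw [← hkn]
    exact (hk ⟨0, hd⟩).trans (Finset.single_le_sum (f := k) (fun _ _ => Nat.zero_le _)
      (Finset.mem_univ _))
  have hd0 : d ≠ 0 := by omega
  let P := hS.toFinset
  have hP : ∀ p ∉ P, S p = 0 := fun p hp => by simpa [P] using hp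
  obtain ⟨ρ, hρ⟩ := exists_injOn_nat P
  have hsum : ∑ p ∈ P, S p ^ d = 1 := by
    rw [← tsum_eq_sum (L := .unconditional _) fun p hp => by rw [hP p hp, zero_pow hd0]]
    have h := NNReal.rpow_inv_natCast_pow (∑' p, S p ^ d) hd0
    rw [discreteNorm, one_div] at hnorm
    rw [← h, hnorm, one_pow]
  obtain ⟨T, α, hα⟩ := exists_handicap_minPivots hV hk hkn hn hρ (fun p => ((S p ^ d : ℝ≥0) : ℝ))
    (fun p => NNReal.coe_nonneg _) (by exact_mod_cast hsum.le)
  -- The count involves `V` alone, not the minimising family, so one function serves every `j` with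
  -- the same `k j`.
  refine ⟨fun m p V => if p ∈ P then
    ((pivots P ρ α (n * T) V.param p).ncard : ℝ≥0) / ((n * T : ℕ) + 1) ^ m else 0,
    fun p V => ?_, fun j π => sum_pivots_affinePlane_le hρ α (n * T) π⟩
  by_cases hp : p ∈ P
  swap
  · rw [hP p hp, zero_pow hd0, mul_zero]
    exact zero_le
  rw [discreteWedge]
  split_ifs with hspan
  swap
  · rw [zero_mul]
    exact zero_le
  simp only [if_pos hp]
  rw [one_mul, Finset.prod_div_distrib, Finset.prod_pow_eq_pow_sum, hkn, ← mul_div_assoc,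
    le_div_iff₀ (by positivity)]
  have h1 := (hα p hp).trans (Nat.cast_le.mpr (minPivots_le P ρ (n * T) α p hspan))
  have h2 : S p ^ d * ((T : ℝ≥0) + 1) ^ n
      ≤ 2 * ∏ j, ((pivots P ρ α (n * T) (V j).param p).ncard : ℝ≥0) := by
    rw [← NNReal.coe_le_coe]
    push_cast at h1 ⊢
    linarith
  calc S p ^ d * (((n * T : ℕ) : ℝ≥0) + 1) ^ n
      ≤ S p ^ d * ((n : ℝ≥0) * (T + 1)) ^ n := by
        gcongr
        rw [mul_add, mul_one, Nat.cast_mul]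
        gcongr
        exact_mod_cast hn
    _ = n ^ n * (S p ^ d * ((T : ℝ≥0) + 1) ^ n) := by rw [mul_pow]; ring
    _ ≤ n ^ n * (2 * ∏ j, ((pivots P ρ α (n * T) (V j).param p).ncard : ℝ≥0)) := by gcongr
    _ = 2 * n ^ n * ∏ j, ((pivots P ρ α (n * T) (V j).param p).ncard : ℝ≥0) := by ring
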